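/- Let $\mathbb F$ be a field of characteristic $0$ containing a square root $\sqrt2$ of $2$ (for example $\mathbb F=\mathbb C$). Let $E_{i,j}$ be the $7\times 7$ matrix units, and let $\mathcal G_2\subset sl(7,\mathbb F)$ be the Lie subalgebra (of type $G_2$) with basis $$h_1=-2E_{2,2}+E_{3,3}+E_{4,4}+2E_{5,5}-E_{6,6}-E_{7,7},\qquad h_2=E_{2,2}-E_{3,3}-E_{5,5}+E_{6,6},$$ $$E_1=\sqrt2(E_{1,2}-E_{5,1})-E_{3,7}+E_{4,6},\quad E_2=E_{2,3}-E_{6,5},\quad E_3=\sqrt2(E_{1,3}-E_{6,1})+E_{2,7}-E_{4,5},$$ $$E_4=\sqrt2(E_{1,7}-E_{4,1})+E_{6,2}-E_{5,3},\quad E_5=E_{4,2}-E_{5,7},\quad E_6=E_{4,3}-E_{6,7},$$ $$F_1=\sqrt2(E_{2,1}-E_{1,5})-E_{7,3}+E_{6,4},\quad F_2=E_{3,2}-E_{5,6},\quad F_3=\sqrt2(E_{3,1}-E_{1,6})+E_{7,2}-E_{5,4},$$ $$F_4=\sqrt2(E_{7,1}-E_{1,4})+E_{2,6}-E_{3,5},\quad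 F_5=E_{2,4}-E_{7,5},\quad F_6=E_{3,4}-E_{7,6}.$$ Let $H=\mathbb Fh_1+\mathbb Fh_2$, let $E_1,\dots,E_6$ be the positive root vectors, and let $\lambda_1$ be the linear function on $H$ with $\lambda_1(h_1)=1$, $\lambda_1(h_2)=0$. Let $\mathcal G_2$ act on $\mathbb F[x_1,\dots,x_7]$ by $E_{i,j}\mapsto x_i\partial_{x_j}$. Put $$\Delta'=\partial_{x_1}^2+2\partial_{x_2}\partial_{x_5}+2\partial_{x_3}\partial_{x_6}+2\partial_{x_4}\partial_{x_7}.$$ For $k\in\mathbb N=\{0,1,2,\dots\}$ let $V_k$ be the $\mathcal G_2$-submodule generated by $x_4^k$. Then: 1. $V_k$ is an irreducible $\mathcal G_2$-module of highest weight $k\lambda_1$, with highest weight vector $x_4^k$: one has $x_4^k\neq 0$, $E_i(x_4^k)=0$ for $i=1,\dots,6$, and $h(x_4^k)=k\lambda_1(h)\,x_4^k$ for $h\in H$. 2. $V_k$ is the space of all homogeneous polynomials $f$ of degree $k$ with $\Delta'(f)=0$. 3. The polynomials $$\sum_{i_2,i_3,i_4=0}^\infty\frac{(-2)^{i_2+i_3+i_4}\prod_{r=2}^4\binom{m_r}{i_r}\binom{m_{3+r}}{i_r}}{\bigl(1+2\epsilon(i_2+i_3+i_4)\bigr)\binom{2(i_2+i_3+i_4)}{i_2,\;i_3,\;i_4,\;i_2+i_3+i_4}}\;x_1^{\epsilon+2(i_2+i_3+i_4)}\prod_{r=2}^4x_r^{m_r-i_r}x_{3+r}^{m_{3+r}-i_r},$$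 indexed by $\epsilon\in\{0,1\}$ and $m_2,\dots,m_7\in\mathbb N$ with $\epsilon+\sum_{r=2}^7m_r=k$, form a basis of $V_k$. (Terms with a vanishing binomial coefficient in the numerator are zero, so the sums are finite.) -/

import Mathlib

open MvPolynomial

/- The bracket on matrices is the commutator `A * B - B * A`. -/
attribute [local instance 100] LieRing.ofAssociativeRing

namespace G2Poly

/-! Indices are shifted by one: `0, …, 6 : Fin 7` stand for `1, …, 7`.  So the variable `x_i` is
`X (i - 1)`, and the matrix unit `E_{i,j}` is `E (i - 1) (j - 1)`. -/

section Lie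

variable {F : Type*} [Field F]

/-- The matrix unit with `1` in position `(i, j)`. -/
def E (i j : Fin 7) : Matrix (Fin 7) (Fin 7) F := Matrix.single i j 1

/-- The operator `∑_{i,j} A_{i,j} x_i ∂_{x_j}` on polynomials, as a derivation. -/
noncomputable def actDer (A : Matrix (Fin 7) (Fin 7) F) :
    Derivation F (MvPolynomial (Fin 7) F) (MvPolynomial (Fin 7) F) :=
  ∑ i, ∑ j, (A i j) • ((X i : MvPolynomial (Fin 7) F) • pderiv j)

theorem actDer_apply (A : Matrix (Fin 7) (Fin 7) F) (f : MvPolynomial (Fin 7) F) :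
    actDer A f = ∑ i, ∑ j, A i j • (X i * pderiv j f) := by
  have h (S : Finset (Fin 7))
      (D : Fin 7 → Derivation F (MvPolynomial (Fin 7) F) (MvPolynomial (Fin 7) F)) :
      (∑ i ∈ S, D i) f = ∑ i ∈ S, D i f := by
    classical
    induction S using Finset.induction_on with
    | empty => simp
    | insert a S ha ih => simp [Finset.sum_insert ha, ih]
  simp only [actDer, h, Derivation.smul_apply, smul_eq_mul]

theorem actDer_X (A : Matrix (Fin 7) (Fin 7) F) (k : Fin 7) :
    actDer A (X k) = ∑ i, A i k • (X i : MvPolynomial (Fin 7) F) := by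
  rw [actDer_apply]
  refine Finset.sum_congr rfl fun i _ => ?_
  rw [Finset.sum_eq_single k]
  · simp
  · intro b _ hb
    simp [pderiv_X, hb.symm]
  · simp

theorem actDer_mul_X (A B : Matrix (Fin 7) (Fin 7) F) (k : Fin 7) :
    actDer A (actDer B (X k)) = actDer (A * B) (X k) := by
  have h : ∀ v : Fin 7 → F, actDer A (∑ i, v i • (X i : MvPolynomial (Fin 7) F)) =
      ∑ i, v i • actDer A (X i) := by
    intro v
    rw [map_sum]
    exact Finset.sum_congr rfl fun i _ => (actDer A).map_smul (v i) (X i)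
  rw [actDer_X B, h]
  simp only [actDer_X, Matrix.mul_apply, Finset.smul_sum, Finset.sum_smul, smul_smul]
  rw [Finset.sum_comm]
  simp only [mul_comm]

theorem actDer_commutator (A B : Matrix (Fin 7) (Fin 7) F) :
    actDer (A * B - B * A) = ⁅actDer A, actDer B⁆ := by
  apply MvPolynomial.derivation_ext
  intro k
  rw [Derivation.commutator_apply, actDer_mul_X, actDer_mul_X]
  simp only [actDer_X, Matrix.sub_apply, sub_smul, Finset.sum_sub_distrib]

/-- The Lie algebra of `7 × 7` matrices acts on `F[x_1, …, x_7]` by `E_{i,j} ↦ x_i ∂_{x_j}`. -/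
noncomputable instance instLieRingModule :
    LieRingModule (Matrix (Fin 7) (Fin 7) F) (MvPolynomial (Fin 7) F) where
  bracket A f := actDer A f
  add_lie A B f := by
    simp only [actDer_apply, Matrix.add_apply, add_smul, Finset.sum_add_distrib]
  lie_add A f g := map_add (actDer A) f g
  leibniz_lie A B f := by
    change actDer A (actDer B f) = actDer (A * B - B * A) f + actDer B (actDer A f)
    rw [actDer_commutator, Derivation.commutator_apply, sub_add_cancel]

theorem lie_eq (A : Matrix (Fin 7) (Fin 7) F) (f : MvPolynomial (Fin 7) F) :
    ⁅A, f⁆ = ∑ i, ∑ j, A i j • (X i * pderiv j f) :=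
  actDer_apply A f

noncomputable instance instLieModule :
    LieModule F (Matrix (Fin 7) (Fin 7) F) (MvPolynomial (Fin 7) F) where
  smul_lie t A f := by
    simp only [lie_eq, Matrix.smul_apply, Finset.smul_sum, smul_assoc]
  lie_smul t A f := (actDer A).map_smul t f

/-! The elements `h_i`, `E_i`, `F_i` of `sl(7)`.  The parameter `s` is the chosen `√2`. -/

def h₁ : Matrix (Fin 7) (Fin 7) F :=
  (-2 : F) • E 1 1 + E 2 2 + E 3 3 + (2 : F) • E 4 4 - E 5 5 - E 6 6
def h₂ : Matrix (Fin 7) (Fin 7) F := E 1 1 - E 2 2 - E 4 4 + E 5 5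

def E₁ (s : F) : Matrix (Fin 7) (Fin 7) F := s • (E 0 1 - E 4 0) - E 2 6 + E 3 5
def E₂ : Matrix (Fin 7) (Fin 7) F := E 1 2 - E 5 4
def E₃ (s : F) : Matrix (Fin 7) (Fin 7) F := s • (E 0 2 - E 5 0) + E 1 6 - E 3 4
def E₄ (s : F) : Matrix (Fin 7) (Fin 7) F := s • (E 0 6 - E 3 0) + E 5 1 - E 4 2
def E₅ : Matrix (Fin 7) (Fin 7) F := E 3 1 - E 4 6
def E₆ : Matrix (Fin 7) (Fin 7) F := E 3 2 - E 5 6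

def F₁ (s : F) : Matrix (Fin 7) (Fin 7) F := s • (E 1 0 - E 0 4) - E 6 2 + E 5 3
def F₂ : Matrix (Fin 7) (Fin 7) F := E 2 1 - E 4 5
def F₃ (s : F) : Matrix (Fin 7) (Fin 7) F := s • (E 2 0 - E 0 5) + E 6 1 - E 4 3
def F₄ (s : F) : Matrix (Fin 7) (Fin 7) F := s • (E 6 0 - E 0 3) + E 1 5 - E 2 4
def F₅ : Matrix (Fin 7) (Fin 7) F := E 1 3 - E 6 4
def F₆ : Matrix (Fin 7) (Fin 7) F := E 2 3 - E 6 5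

/-- The spanning family `h_1, h_2, E_1, …, E_6, F_1, …, F_6` of `G_2`. -/
def gen (s : F) : Fin 14 → Matrix (Fin 7) (Fin 7) F :=
  ![h₁, h₂, E₁ s, E₂, E₃ s, E₄ s, E₅, E₆, F₁ s, F₂, F₃ s, F₄ s, F₅, F₆]

/-- The element of `G_2` with given coordinates, as an explicit matrix. -/
def mat (s : F) (a : Fin 14 → F) : Matrix (Fin 7) (Fin 7) F := !![
      0, s * a 2, s * a 4, -(s * a 11), -(s * a 8), -(s * a 10), s * a 5;
      s * a 8, -2 * a 0 + a 1, a 3, a 12, 0, a 11, a 4;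
      s * a 10, a 9, a 0 - a 1, a 13, -a 11, 0, -a 2;
      -(s * a 5), a 6, a 7, a 0, -a 4, a 2, 0;
      -(s * a 2), 0, -a 5, -a 10, 2 * a 0 - a 1, -a 9, -a 6;
      -(s * a 4), a 5, 0, a 8, -a 3, -a 0 + a 1, -a 7;
      s * a 11, a 10, -a 8, 0, -a 12, -a 13, -a 0]

theorem E_apply (i j k l : Fin 7) : (E i j : Matrix (Fin 7) (Fin 7) F) k l =
    if i = k ∧ j = l then 1 else 0 := rfl

set_option maxHeartbeats 4000000 in
theorem sum_gen (s : F) (a : Fin 14 → F) : ∑ i, a i • gen s i = mat s a := by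
  have h : ∑ i, a i • gen s i = a 0 • h₁ + a 1 • h₂ + a 2 • E₁ s + a 3 • E₂ + a 4 • E₃ s
     + a 5 • E₄ s + a 6 • E₅ + a 7 • E₆ + a 8 • F₁ s + a 9 • F₂ + a 10 • F₃ s + a 11 • F₄ s +
     a 12 • F₅ + a 13 • F₆ := by
    simp only [Fin.sum_univ_succ, Finset.univ_eq_empty, Finset.sum_empty, add_zero, add_assoc]
    rfl
  rw [h]
  simp only [h₁, h₂, E₁, E₂, E₃, E₄, E₅, E₆, F₁, F₂, F₃, F₄, F₅, F₆]
  ext i j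
  simp only [Matrix.add_apply, Matrix.sub_apply, Matrix.smul_apply, E_apply, smul_eq_mul]
  fin_cases i <;> fin_cases j <;> simp [mat] <;> ring

set_option maxHeartbeats 8000000 in
theorem lie_mat (s : F) (hs : s ^ 2 = 2) (a b : Fin 14 → F) :
    ∃ c, ⁅mat s a, mat s b⁆ = mat s c := by
  have h3 : s ^ 3 = 2 * s := by rw [pow_succ, hs]
  set C := ⁅mat s a, mat s b⁆ with hC
  refine ⟨![C 3 3, C 1 1 + 2 * C 3 3, C 3 5, C 1 2, C 1 6, C 5 1, C 3 1, C 3 2, C 5 3, C 2 1, C 6 1,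
    C 1 5, C 1 3, C 2 3], ?_⟩
  rw [hC, Ring.lie_def]
  ext i j
  rw [Matrix.sub_apply, Matrix.mul_apply, Matrix.mul_apply]
  simp only [Fin.sum_univ_seven, Matrix.sub_apply, Matrix.mul_apply]
  fin_cases i <;> fin_cases j <;>
    simp only [mat, Fin.reduceFinMk, Fin.zero_eta, Fin.mk_one, Fin.isValue, Matrix.of_apply,
      Matrix.cons_val] <;>
    first
      | done
      | ring1
      | (ring_nf; simp only [hs, h3]; ring1)
theorem lie_mem_span (s : F) (hs : s ^ 2 = 2) (a b : Fin 14 → F) :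
    ⁅∑ i, a i • gen s i, ∑ i, b i • gen s i⁆ ∈ Submodule.span F (Set.range (gen s)) := by
  obtain ⟨c, hc⟩ := lie_mat s hs a b
  rw [sum_gen, sum_gen, hc, ← sum_gen]
  exact (Submodule.mem_span_range_iff_exists_fun F).2 ⟨c, rfl⟩

/-- The Lie algebra `G_2`: the span of the `h_i`, `E_i`, `F_i`, as a Lie subalgebra. -/
def g2 (s : F) (hs : s ^ 2 = 2) : LieSubalgebra F (Matrix (Fin 7) (Fin 7) F) where
  __ := Submodule.span F (Set.range (gen s))
  lie_mem' := by
    intro x y hx hy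
    obtain ⟨a, rfl⟩ := (Submodule.mem_span_range_iff_exists_fun F).1 hx
    obtain ⟨b, rfl⟩ := (Submodule.mem_span_range_iff_exists_fun F).1 hy
    exact lie_mem_span s hs a b

theorem g2_le_sl (s : F) (hs : s ^ 2 = 2) : g2 s hs ≤ LieAlgebra.SpecialLinear.sl (Fin 7) F := by
  intro x hx
  obtain ⟨a, rfl⟩ := (Submodule.mem_span_range_iff_exists_fun F).1 hx
  change Matrix.trace (∑ i, a i • gen s i) = 0
  rw [sum_gen]
  simp only [mat, Matrix.trace, Matrix.diag_apply, Fin.sum_univ_seven, Matrix.of_apply,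
    Matrix.cons_val]
  ring

variable (F) in
/-- The Cartan subalgebra `H`, the span of `h_1` and `h_2`. -/
def cartan : Submodule F (Matrix (Fin 7) (Fin 7) F) := Submodule.span F {h₁, h₂}

variable (F) in
/-- The fundamental weight `λ_1`: the linear function on `H` with `λ_1(h_1) = 1` and
`λ_1(h_2) = 0`.  On `H` it is the matrix entry in position `(4, 4)`. -/
def fundWeight₁ : cartan F →ₗ[F] F := (Matrix.entryLinearMap F F 3 3).comp (cartan F).subtype

theorem fundWeight₁_h₁ (h : h₁ ∈ cartan F) : fundWeight₁ F ⟨h₁, h⟩ = 1 := by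
  simp [fundWeight₁, h₁, E_apply]

theorem fundWeight₁_h₂ (h : h₂ ∈ cartan F) : fundWeight₁ F ⟨h₂, h⟩ = 0 := by
  simp [fundWeight₁, h₂, E_apply]

/-- `f` is a singular vector of weight `μ`: it is nonzero, is killed by `E_1, …, E_6`, and `H`
acts on it by `μ`. -/
def IsSingular (s : F) (f : MvPolynomial (Fin 7) F) (μ : cartan F →ₗ[F] F) : Prop :=
  f ≠ 0 ∧
  (⁅E₁ s, f⁆ = 0 ∧ ⁅(E₂ : Matrix (Fin 7) (Fin 7) F), f⁆ = 0 ∧ ⁅E₃ s, f⁆ = 0 ∧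
    ⁅E₄ s, f⁆ = 0 ∧ ⁅(E₅ : Matrix (Fin 7) (Fin 7) F), f⁆ = 0 ∧
    ⁅(E₆ : Matrix (Fin 7) (Fin 7) F), f⁆ = 0) ∧
  ∀ h : cartan F, ⁅(h : Matrix (Fin 7) (Fin 7) F), f⁆ = μ h • f

/-- `N` is a highest weight module of highest weight `μ` with highest weight vector `f`: `f` is a
singular vector of weight `μ` that generates `N`. -/
def IsHighestWeightVector (s : F) (hs : s ^ 2 = 2)
    (N : LieSubmodule F (g2 s hs) (MvPolynomial (Fin 7) F)) (f : MvPolynomial (Fin 7) F)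
    (μ : cartan F →ₗ[F] F) : Prop :=
  IsSingular s f μ ∧ LieSubmodule.lieSpan F (g2 s hs) {f} = N

/-- The `G_2`-submodule `V_k` of `F[x_1, …, x_7]` generated by `x_4 ^ k`. -/
noncomputable def V (s : F) (hs : s ^ 2 = 2) (k : ℕ) :
    LieSubmodule F (g2 s hs) (MvPolynomial (Fin 7) F) :=
  LieSubmodule.lieSpan F (g2 s hs) {X 3 ^ k}

variable (F) in
/-- The operator `Δ' = ∂_1² + 2 ∂_2 ∂_5 + 2 ∂_3 ∂_6 + 2 ∂_4 ∂_7`. -/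
noncomputable def lap : MvPolynomial (Fin 7) F →ₗ[F] MvPolynomial (Fin 7) F :=
  let d (i : Fin 7) : MvPolynomial (Fin 7) F →ₗ[F] MvPolynomial (Fin 7) F := (pderiv i).toLinearMap
  d 0 ∘ₗ d 0 + (2 : F) • (d 1 ∘ₗ d 4) + (2 : F) • (d 2 ∘ₗ d 5) + (2 : F) • (d 3 ∘ₗ d 6)

/-- The parameters `(ε, (m_2, m_3, m_4), (m_5, m_6, m_7))` with `ε ∈ {0, 1}` and
`ε + m_2 + ⋯ + m_7 = k`. -/
abbrev Index (k : ℕ) : Type :=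
  {p : Fin 2 × (Fin 3 → ℕ) × (Fin 3 → ℕ) // (p.1 : ℕ) + ∑ r, p.2.1 r + ∑ r, p.2.2 r = k}

variable (F) in
/-- The explicit polynomial with parameters `ε`, `m = (m_2, m_3, m_4)`, `m' = (m_5, m_6, m_7)`.
The summation index is `i = (i_2, i_3, i_4)`; terms with some `i_r > m_r` are left out, since
they carry a vanishing binomial coefficient (as do those with `i_r > m_{3+r}`, so that the
truncated subtraction in an exponent never matters). -/
noncomputable def basisPoly (ε : Fin 2) (m m' : Fin 3 → ℕ) : MvPolynomial (Fin 7) F :=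
  ∑ i ∈ Fintype.piFinset fun r => Finset.range (m r + 1),
    C ((-2 : F) ^ (∑ r, i r) * (∏ r, ((m r).choose (i r) : F) * ((m' r).choose (i r) : F)) /
        ((1 + 2 * (ε : ℕ) * (∑ r, i r) : ℕ) *
          (Nat.multinomial Finset.univ ![i 0, i 1, i 2, ∑ r, i r] : F))) *
      X 0 ^ ((ε : ℕ) + 2 * ∑ r, i r) *
      ∏ r : Fin 3, (X (![1, 2, 3] r) ^ (m r - i r) * X (![4, 5, 6] r) ^ (m' r - i r))

end Lie

end G2Poly

/-! The matrices of `g2` are skew for the quadratic form x_1² + 2(x_2 x_5 + x_3 x_6 + x_4 x_7), so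
they commute with Δ' (`lap_lie`), and the Δ'-harmonic polynomials of degree k form a submodule,
`harmonic`.

Everything about modules rests on one fact: every nonzero submodule of `harmonic` contains x_4^k
(`X_pow_mem_of_ne_bot`). The operators E_1, E_3, E_4, E_5, E_6 strictly raise a weight that is
bounded in degree k, so such a submodule has a nonzero vector that they all kill; their equations
together with Δ' f = 0 leave only the multiples of x_4^k (`eq_smul_X_pow_of_singular`).
Irreducibility of V_k follows at once.

For V_k = `harmonic`, the apolar form makes the transposed matrix the adjoint, and `g2` is stable
under transposition. Hence the orthogonal of V_k inside `harmonic` is a submodule. Were it nonzero,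
it would contain x_4^k, whose apolar square is k! ≠ 0. So `harmonic` embeds in the dual of V_k, and
the dimensions agree. Complete reducibility and dimension formulas are not needed.

For the basis, Δ' f = 0 is a recursion in the exponent of x_1: the coefficients of degree at most
one in x_1 determine f (`eq_zero_of_lap_eq_zero`). The explicit polynomial is the harmonic one whose
part of degree at most one in x_1 is the single monomial of its i = 0 term (`lap_basisPoly`,
`coeff_basisPoly`). -/

namespace G2Poly

section

variable {F : Type*} [Field F]

/-! ### Invariance of Δ' and the submodule of harmonic polynomials -/

/-- The involution `1 ↦ 1`, `r ↔ r + 3` of the indices that pairs dual variables. -/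
def dualIdx : Fin 7 → Fin 7 := ![0, 4, 5, 6, 1, 2, 3]

theorem dualIdx_dualIdx (i : Fin 7) : dualIdx (dualIdx i) = i := by
  revert i; decide

theorem pderiv_pderiv_comm {σ R : Type*} [CommSemiring R] (i j : σ) (f : MvPolynomial σ R) :
    pderiv i (pderiv j f) = pderiv j (pderiv i f) := by
  classical
  ext d
  simp only [coeff_pderiv]
  rw [add_right_comm]
  by_cases h : i = j
  · subst h; ring
  · simp [h, Ne.symm h]
    ring

theorem coeff_X_mul_pderiv_self {σ R : Type*} [CommSemiring R] (i : σ) (f : MvPolynomial σ R)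
    (d : σ →₀ ℕ) : coeff d (X i * pderiv i f) = d i * coeff d f := by
  classical
  rw [coeff_X_mul']
  split_ifs with h
  · have h1 : 1 ≤ d i := Nat.one_le_iff_ne_zero.2 (Finsupp.mem_support_iff.1 h)
    rw [coeff_pderiv, tsub_add_cancel_of_le (by simpa using h1), mul_comm]
    congr 1
    rw [Finsupp.tsub_apply, Finsupp.single_eq_same]
    exact_mod_cast congrArg (Nat.cast (R := R)) (Nat.sub_add_cancel h1)
  · simp [Finsupp.notMem_support_iff.1 h]

/-- The operator x_i ∂_j trades one x_j for one x_i in each monomial; stated additively, so that any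
weight can be applied to both sides. -/
theorem exists_of_coeff_X_mul_pderiv_ne_zero {σ R : Type*} [CommSemiring R] {i j : σ}
    {f : MvPolynomial σ R} {d : σ →₀ ℕ} (h : coeff d (X i * pderiv j f) ≠ 0) :
    ∃ d', coeff d' f ≠ 0 ∧ d + Finsupp.single j 1 = d' + Finsupp.single i 1 := by
  classical
  rw [coeff_X_mul'] at h
  split_ifs at h with hi
  · rw [coeff_pderiv] at h
    refine ⟨_, left_ne_zero_of_mul h, ?_⟩
    have h1 : 1 ≤ d i := Nat.one_le_iff_ne_zero.2 (Finsupp.mem_support_iff.1 hi)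
    rw [add_right_comm, tsub_add_cancel_of_le (by simpa using h1)]
  · exact absurd rfl h

theorem lap_apply (f : MvPolynomial (Fin 7) F) :
    lap F f = ∑ i, pderiv i (pderiv (dualIdx i) f) := by
  change pderiv 0 (pderiv 0 f) + (2 : F) • pderiv 1 (pderiv 4 f) +
    (2 : F) • pderiv 2 (pderiv 5 f) + (2 : F) • pderiv 3 (pderiv 6 f) = _
  simp only [Fin.sum_univ_seven, dualIdx, Matrix.cons_val, two_smul]
  rw [pderiv_pderiv_comm 4 1, pderiv_pderiv_comm 5 2, pderiv_pderiv_comm 6 3]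
  abel

theorem pderiv_lie (A : Matrix (Fin 7) (Fin 7) F) (f : MvPolynomial (Fin 7) F) (k : Fin 7) :
    pderiv k ⁅A, f⁆ = ⁅A, pderiv k f⁆ + ∑ j, A k j • pderiv j f := by
  have h1 : ∑ j, A k j • pderiv j f =
      ∑ i, ∑ j, A i j • (pderiv k (X i : MvPolynomial (Fin 7) F) * pderiv j f) := by
    symm
    rw [Finset.sum_eq_single k]
    · simp
    · intro b _ hb
      simp [pderiv_X_of_ne hb]
    · simp
  rw [lie_eq, lie_eq, h1, ← Finset.sum_add_distrib, map_sum]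
  refine Finset.sum_congr rfl fun i _ => ?_
  rw [← Finset.sum_add_distrib, map_sum]
  refine Finset.sum_congr rfl fun j _ => ?_
  rw [Derivation.map_smul, pderiv_mul, smul_add, add_comm, pderiv_pderiv_comm k j]

/-- Commuting A past both derivatives in each ∂_i ∂_{i*} leaves two sums of second derivatives.
Skewness of A and symmetry of ∂_i ∂_j make them cancel. -/
theorem lap_lie {A : Matrix (Fin 7) (Fin 7) F}
    (hA : ∀ i j, A i j = -A (dualIdx j) (dualIdx i)) (f : MvPolynomial (Fin 7) F) :
    lap F ⁅A, f⁆ = ⁅A, lap F f⁆ := by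
  have hlie : ∀ g : Fin 7 → MvPolynomial (Fin 7) F, ⁅A, ∑ i, g i⁆ = ∑ i, ⁅A, g i⁆ :=
    fun g => map_sum (actDer A) g _
  have e : ∀ g : Fin 7 → MvPolynomial (Fin 7) F, ∑ i, g (dualIdx i) = ∑ i, g i := fun g =>
    Equiv.sum_comp (Function.Involutive.toPerm dualIdx dualIdx_dualIdx) g
  simp only [lap_apply, pderiv_lie, map_add, map_sum, Derivation.map_smul, hlie,
    Finset.sum_add_distrib]
  rw [add_assoc, add_eq_left]
  have h1 : ∑ i, ∑ j, A (dualIdx i) j • pderiv i (pderiv j f) =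
      ∑ j, ∑ i, -(A (dualIdx j) i • pderiv i (pderiv j f)) := by
    rw [Finset.sum_comm]
    refine Finset.sum_congr rfl fun j _ => Finset.sum_congr rfl fun i _ => ?_
    rw [hA, dualIdx_dualIdx, neg_smul]
  have h2 : ∑ i, ∑ j, A i j • pderiv j (pderiv (dualIdx i) f) =
      ∑ j, ∑ i, A (dualIdx j) i • pderiv i (pderiv j f) := by
    rw [← e]
    simp only [dualIdx_dualIdx]
  rw [h1, h2]
  simp only [Finset.sum_neg_distrib, add_neg_cancel]

theorem lie_isHomogeneous (A : Matrix (Fin 7) (Fin 7) F) {f : MvPolynomial (Fin 7) F} {k : ℕ}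
    (hf : f.IsHomogeneous k) : (⁅A, f⁆ : MvPolynomial (Fin 7) F).IsHomogeneous k := by
  rw [lie_eq]
  refine IsHomogeneous.sum _ _ _ fun i _ => IsHomogeneous.sum _ _ _ fun j _ => ?_
  rw [← mem_homogeneousSubmodule]
  refine Submodule.smul_mem _ _ ?_
  rw [mem_homogeneousSubmodule]
  intro d hd
  obtain ⟨d', h', h⟩ := exists_of_coeff_X_mul_pderiv_ne_zero hd
  have := congrArg (Finsupp.weight (1 : Fin 7 → ℕ)) h
  simp only [map_add, Finsupp.weight_single, Pi.one_apply, hf h'] at this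
  exact Nat.add_right_cancel this

theorem exists_mat_of_mem {s : F} {hs : s ^ 2 = 2} {A : Matrix (Fin 7) (Fin 7) F}
    (hA : A ∈ g2 s hs) : ∃ a, A = mat s a := by
  obtain ⟨a, rfl⟩ := (Submodule.mem_span_range_iff_exists_fun F).1 hA
  exact ⟨a, sum_gen s a⟩

theorem mat_mem (s : F) (hs : s ^ 2 = 2) (a : Fin 14 → F) : mat s a ∈ g2 s hs := by
  rw [← sum_gen]
  exact (Submodule.mem_span_range_iff_exists_fun F).2 ⟨a, rfl⟩

theorem mat_skew (s : F) (a : Fin 14 → F) (i j : Fin 7) :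
    mat s a i j = -mat s a (dualIdx j) (dualIdx i) := by
  fin_cases i <;> fin_cases j <;> simp [mat, dualIdx] <;> ring

/-- Transposition fixes h_1, h_2 and exchanges each E_i with F_i, hence the permutation of
coordinates. -/
theorem mat_transpose (s : F) (a : Fin 14 → F) :
    (mat s a).transpose = mat s fun i =>
      a ((![0, 1, 8, 9, 10, 11, 12, 13, 2, 3, 4, 5, 6, 7] : Fin 14 → Fin 14) i) := by
  ext i j
  fin_cases i <;> fin_cases j <;> simp [mat]

theorem transpose_mem {s : F} {hs : s ^ 2 = 2} {A : Matrix (Fin 7) (Fin 7) F}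
    (hA : A ∈ g2 s hs) : A.transpose ∈ g2 s hs := by
  obtain ⟨a, rfl⟩ := exists_mat_of_mem hA
  rw [mat_transpose]
  exact mat_mem _ _ _

/-- The harmonic polynomials of degree `k`, as a `G_2`-submodule. -/
noncomputable def harmonic (s : F) (hs : s ^ 2 = 2) (k : ℕ) :
    LieSubmodule F (g2 s hs) (MvPolynomial (Fin 7) F) where
  __ := homogeneousSubmodule (Fin 7) F k ⊓ LinearMap.ker (lap F)
  lie_mem := by
    rintro ⟨A, hA⟩ f ⟨h1, h2⟩
    obtain ⟨a, rfl⟩ := exists_mat_of_mem hA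
    refine ⟨lie_isHomogeneous _ h1, ?_⟩
    change lap F ⁅mat s a, f⁆ = 0
    rw [lap_lie (mat_skew s a), LinearMap.mem_ker.1 h2, lie_zero]

theorem mem_harmonic {s : F} {hs : s ^ 2 = 2} {k : ℕ} {f : MvPolynomial (Fin 7) F} :
    f ∈ harmonic s hs k ↔ f.IsHomogeneous k ∧ lap F f = 0 := Iff.rfl

/-! ### The vector x_4^k -/

theorem lie_X_pow (A : Matrix (Fin 7) (Fin 7) F) (j : Fin 7) (k : ℕ) :
    ⁅A, (X j ^ k : MvPolynomial (Fin 7) F)⁆ =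
      ∑ i, A i j • (X i * ((k : MvPolynomial (Fin 7) F) * X j ^ (k - 1))) := by
  rw [lie_eq]
  refine Finset.sum_congr rfl fun i _ => ?_
  rw [Finset.sum_eq_single j]
  · simp
  · intro b _ hb
    simp [pderiv_X_of_ne hb.symm]
  · simp

theorem X_pow_mem_harmonic (s : F) (hs : s ^ 2 = 2) (k : ℕ) : X 3 ^ k ∈ harmonic s hs k := by
  refine mem_harmonic.2 ⟨by simpa using (isHomogeneous_X F (3 : Fin 7)).pow k, ?_⟩
  rw [lap_apply]
  refine Finset.sum_eq_zero fun i _ => ?_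
  by_cases h : dualIdx i = 3
  · have : i = 6 := by revert i; decide
    subst this
    rw [pderiv_pderiv_comm, pderiv_pow, pderiv_X_of_ne (by decide)]
    simp
  · rw [pderiv_pow, pderiv_X_of_ne (Ne.symm h)]
    simp

theorem isSingular_X_pow [CharZero F] (s : F) (k : ℕ) :
    IsSingular s (X 3 ^ k) (k • fundWeight₁ F) := by
  have h0 : ∀ A : Matrix (Fin 7) (Fin 7) F, (∀ i, A i 3 = 0) →
      ⁅A, (X 3 ^ k : MvPolynomial (Fin 7) F)⁆ = 0 := by
    intro A hA
    rw [lie_X_pow]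
    simp [hA]
  refine ⟨pow_ne_zero _ (X_ne_zero _), ⟨?_, ?_, ?_, ?_, ?_, ?_⟩, ?_⟩
  iterate 6
    apply h0
    intro i
    fin_cases i <;> simp [E₁, E₂, E₃, E₄, E₅, E₆, E_apply]
  rintro ⟨A, hA⟩
  have hA' : ∀ i, i ≠ 3 → A i 3 = 0 := by
    intro i hi
    induction hA using Submodule.span_induction with
    | mem x hx =>
      rcases hx with rfl | rfl <;> fin_cases i <;> simp [h₁, h₂, E_apply] at hi ⊢
    | zero => rfl
    | add x y _ _ h1 h2 => rw [Matrix.add_apply, h1, h2, add_zero]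
    | smul c x _ h1 => rw [Matrix.smul_apply, h1, smul_zero]
  change ⁅A, (X 3 ^ k : MvPolynomial (Fin 7) F)⁆ = (k • A 3 3) • X 3 ^ k
  rw [lie_X_pow, Finset.sum_eq_single 3 (fun i _ hi => by rw [hA' i hi, zero_smul]) (by simp)]
  cases k with
  | zero => simp
  | succ n => simp [smul_eq_C_mul]; ring

/-! ### Singular vectors among the harmonic polynomials -/

theorem lie_E (i j : Fin 7) (f : MvPolynomial (Fin 7) F) :
    ⁅(E i j : Matrix (Fin 7) (Fin 7) F), f⁆ = X i * pderiv j f := by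
  rw [lie_eq, Finset.sum_eq_single i, Finset.sum_eq_single j]
  · simp [E_apply]
  · intro b _ hb
    simp [E_apply, hb.symm]
  · simp
  · intro b _ hb
    simp [E_apply, hb.symm]
  · simp

theorem eq_smul_X_pow_of_pderiv_eq_zero [CharZero F] {k : ℕ} {f : MvPolynomial (Fin 7) F}
    (hf : f.IsHomogeneous k) (h : ∀ i, i ≠ 3 → pderiv i f = 0) :
    f = coeff (Finsupp.single 3 k) f • X 3 ^ k := by
  ext d
  rw [coeff_smul, coeff_X_pow]
  split_ifs with hd
  · rw [hd, smul_eq_mul, mul_one]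
  · rw [smul_zero]
    by_contra hc
    have h0 : ∀ i, i ≠ 3 → d i = 0 := by
      intro i hi
      have := coeff_X_mul_pderiv_self i f d
      rw [h i hi, mul_zero, coeff_zero, eq_comm, mul_eq_zero] at this
      exact_mod_cast this.resolve_right hc
    have hdeg := hf hc
    rw [Finsupp.weight_eq_sum, Finset.sum_eq_single 3 (fun i _ hi => by simp [h0 i hi])
      (by simp)] at hdeg
    apply hd
    ext i
    by_cases hi : i = 3
    · subst hi
      simpa using hdeg.symm
    · simp [h0 i hi, Ne.symm hi]

/-- Put p = ∂_7 f. Applying ∂_i to the five relations and adding turns x_4 Δ' f = 0 into 5p + ∑ x_i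
∂_i p + 2 x_4 ∂_4 p = 0, the sum over i ≠ 4, 7. This operator is diagonal on monomials with
eigenvalues at least 5, so p = 0. -/
theorem eq_zero_of_harmonic_relations [CharZero F] {f : MvPolynomial (Fin 7) F}
    (hl : lap F f = 0) (h : ∀ i, i ≠ 3 → X 3 * pderiv (dualIdx i) f = X i * pderiv 6 f ∨ i = 6) :
    pderiv 6 f = 0 := by
  set p := pderiv 6 f with hp
  have hd : ∀ i, i ≠ 3 → i ≠ 6 → X 3 * pderiv i (pderiv (dualIdx i) f) = p + X i * pderiv i p := by
    intro i h3 h6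
    have := congrArg (pderiv i) ((h i h3).resolve_right h6)
    rwa [pderiv_mul, pderiv_mul, pderiv_X_of_ne (Ne.symm h3), pderiv_X_self, zero_mul, zero_add,
      one_mul] at this
  have key : 5 * p + X 0 * pderiv 0 p + X 1 * pderiv 1 p + X 2 * pderiv 2 p + X 4 * pderiv 4 p +
      X 5 * pderiv 5 p + 2 * (X 3 * pderiv 3 p) = 0 := by
    rw [lap_apply, Fin.sum_univ_seven] at hl
    have h3 : pderiv 3 (pderiv (dualIdx 3) f) = pderiv 3 p := rfl
    have h6 : pderiv 6 (pderiv (dualIdx 6) f) = pderiv 3 p := pderiv_pderiv_comm _ _ _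
    rw [h3, h6] at hl
    linear_combination X 3 * hl - hd 0 (by decide) (by decide) - hd 1 (by decide) (by decide) -
      hd 2 (by decide) (by decide) - hd 4 (by decide) (by decide) - hd 5 (by decide) (by decide)
  ext d
  have hc := congrArg (coeff d) key
  have c5 : (5 : MvPolynomial (Fin 7) F) = C 5 := rfl
  have c2 : (2 : MvPolynomial (Fin 7) F) = C 2 := rfl
  simp only [c5, c2, coeff_add, coeff_C_mul, coeff_X_mul_pderiv_self, coeff_zero] at hc
  have hne : ((5 + d 0 + d 1 + d 2 + d 4 + d 5 + 2 * d 3 : ℕ) : F) ≠ 0 := by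
    rw [Nat.cast_ne_zero]
    omega
  rw [coeff_zero]
  refine (mul_eq_zero.1 ?_).resolve_left hne
  push_cast
  linear_combination hc

theorem eq_smul_X_pow_of_singular [CharZero F] {s : F} (hs : s ^ 2 = 2) {k : ℕ}
    {f : MvPolynomial (Fin 7) F} (hf : f.IsHomogeneous k) (hl : lap F f = 0)
    (h1 : ⁅E₁ s, f⁆ = 0) (h3 : ⁅E₃ s, f⁆ = 0) (h4 : ⁅E₄ s, f⁆ = 0)
    (h5 : ⁅(E₅ : Matrix (Fin 7) (Fin 7) F), f⁆ = 0)
    (h6 : ⁅(E₆ : Matrix (Fin 7) (Fin 7) F), f⁆ = 0) :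
    ∃ c : F, f = c • X 3 ^ k := by
  have hX : (X 3 : MvPolynomial (Fin 7) F) ≠ 0 := X_ne_zero _
  have hC : (C s : MvPolynomial (Fin 7) F) ≠ 0 := by
    rw [Ne, C_eq_zero]
    rintro rfl
    norm_num at hs
  simp only [E₁, E₃, E₄, E₅, E₆, sub_lie, add_lie, smul_lie, lie_E, smul_eq_C_mul] at h1 h3 h4 h5 h6
  -- After multiplication by x_4, the E_5 and E_6 equations eliminate ∂_2 and ∂_3 from the E_4
  -- equation. The E_3 and E_1 equations then yield to the same elimination, with this relation used
  -- for ∂_1.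
  have r0 : X 3 * pderiv 0 f = X 0 * pderiv 6 f := by
    refine mul_left_cancel₀ (mul_ne_zero hC hX) ?_
    linear_combination -X 3 * h4 + X 5 * h5 - X 4 * h6
  have r4 : X 3 * pderiv 4 f = X 1 * pderiv 6 f := by
    refine mul_left_cancel₀ hX ?_
    linear_combination -X 3 * h3 + C s * X 0 * h6 - C s * X 5 * r0
  have r5 : X 3 * pderiv 5 f = X 2 * pderiv 6 f := by
    refine mul_left_cancel₀ hX ?_
    linear_combination X 3 * h1 - C s * X 0 * h5 + C s * X 4 * r0
  have r1 : X 3 * pderiv 1 f = X 4 * pderiv 6 f := by linear_combination h5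
  have r2 : X 3 * pderiv 2 f = X 5 * pderiv 6 f := by linear_combination h6
  have h0 : pderiv 6 f = 0 := by
    refine eq_zero_of_harmonic_relations hl fun i hi => ?_
    fin_cases i
    exacts [.inl r0, .inl r4, .inl r5, absurd rfl hi, .inl r1, .inl r2, .inr rfl]
  rw [h0, mul_zero] at r0 r1 r2 r4 r5
  refine ⟨_, eq_smul_X_pow_of_pderiv_eq_zero hf fun i hi => ?_⟩
  fin_cases i
  exacts [(mul_eq_zero.1 r0).resolve_left hX, (mul_eq_zero.1 r1).resolve_left hX,
    (mul_eq_zero.1 r2).resolve_left hX, absurd rfl hi, (mul_eq_zero.1 r4).resolve_left hX,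
    (mul_eq_zero.1 r5).resolve_left hX, h0]

/-- An Engel-type argument: otherwise some element of S could always be applied without reaching 0,
giving nonzero elements of N whose monomials all have arbitrarily large weight, whereas a monomial
of degree k has weight at most k ∑ w_i. -/
theorem exists_forall_lie_eq_zero (w : Fin 7 → ℕ) (S : Set (Matrix (Fin 7) (Fin 7) F))
    (hS : ∀ A ∈ S, ∀ i j, A i j ≠ 0 → w j < w i) {k : ℕ}
    {N : Submodule F (MvPolynomial (Fin 7) F)} (hN : N ≤ homogeneousSubmodule (Fin 7) F k)
    (hSN : ∀ A ∈ S, ∀ f ∈ N, ⁅A, f⁆ ∈ N) (h0 : N ≠ ⊥) :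
    ∃ f ∈ N, f ≠ 0 ∧ ∀ A ∈ S, ⁅A, f⁆ = 0 := by
  by_contra! hcon
  have key : ∀ n, ∃ f ∈ N, f ≠ 0 ∧ ∀ d, coeff d f ≠ 0 → n ≤ Finsupp.weight w d := by
    intro n
    induction n with
    | zero =>
      obtain ⟨f, hf, h⟩ := Submodule.exists_mem_ne_zero_of_ne_bot h0
      exact ⟨f, hf, h, fun _ _ => Nat.zero_le _⟩
    | succ n ih =>
      obtain ⟨f, hf, hf0, hw⟩ := ih
      obtain ⟨A, hA, hAf⟩ := hcon f hf hf0
      refine ⟨_, hSN A hA f hf, hAf, fun d hd => ?_⟩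
      rw [lie_eq, coeff_sum] at hd
      obtain ⟨i, _, hd⟩ := Finset.exists_ne_zero_of_sum_ne_zero hd
      rw [coeff_sum] at hd
      obtain ⟨j, _, hd⟩ := Finset.exists_ne_zero_of_sum_ne_zero hd
      rw [coeff_smul, smul_eq_mul] at hd
      obtain ⟨d', h', h⟩ := exists_of_coeff_X_mul_pderiv_ne_zero (right_ne_zero_of_mul hd)
      have h1 := hS A hA i j (left_ne_zero_of_mul hd)
      have h2 := hw d' h'
      have h3 := congrArg (Finsupp.weight w) h
      simp only [map_add, Finsupp.weight_single, one_smul] at h3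
      omega
  obtain ⟨f, hf, hf0, hw⟩ := key ((∑ i, w i) * k + 1)
  obtain ⟨d, hd⟩ := ne_zero_iff.1 hf0
  have h1 := hw d hd
  have h2 : Finsupp.weight 1 d = k := hN hf hd
  rw [Finsupp.weight_eq_sum] at h1 h2
  have h3 : ∑ i, d i • w i ≤ ∑ i, d i * ∑ j, w j :=
    Finset.sum_le_sum fun i _ => Nat.mul_le_mul_left _
      (Finset.single_le_sum (f := w) (fun _ _ => Nat.zero_le _) (Finset.mem_univ i))
  rw [← Finset.sum_mul] at h3
  simp only [Pi.one_apply, smul_eq_mul, mul_one] at h2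
  rw [h2, mul_comm] at h3
  omega

theorem gen_mem (s : F) (hs : s ^ 2 = 2) (i : Fin 14) : gen s i ∈ g2 s hs :=
  Submodule.subset_span ⟨i, rfl⟩

theorem X_pow_mem_of_ne_bot [CharZero F] {s : F} {hs : s ^ 2 = 2} {k : ℕ}
    {N : LieSubmodule F (g2 s hs) (MvPolynomial (Fin 7) F)} (hN : N ≤ harmonic s hs k)
    (h0 : N ≠ ⊥) : X 3 ^ k ∈ N := by
  -- The weights grade the variables in the order x_7, x_3, x_2, x_1, x_5, x_6, x_4, from 0 to 6;
  -- E_1, E_3, E_4, E_5, E_6 raise them by 1, 2, 3, 4, 5.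
  have hS : ∀ i : Fin 5, ∀ a b, (![E₁ s, E₃ s, E₄ s, E₅, E₆] : Fin 5 → _) i a b ≠ 0 →
      (![3, 2, 1, 6, 4, 5, 0] : Fin 7 → ℕ) b < (![3, 2, 1, 6, 4, 5, 0] : Fin 7 → ℕ) a := by
    intro i a b
    fin_cases i <;> fin_cases a <;> fin_cases b <;> simp [E₁, E₃, E₄, E₅, E₆, E_apply]
  obtain ⟨f, hf, hf0, h⟩ := exists_forall_lie_eq_zero ![3, 2, 1, 6, 4, 5, 0]
    (Set.range ![E₁ s, E₃ s, E₄ s, E₅, E₆]) (by rintro _ ⟨i, rfl⟩; exact hS i)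
    (N := N.toSubmodule) (k := k) (fun f hf => (hN hf).1)
    (by
      rintro _ ⟨i, rfl⟩ f hf
      have := fun j => N.lie_mem (x := ⟨gen s j, gen_mem s hs j⟩) hf
      fin_cases i
      exacts [this 2, this 4, this 5, this 6, this 7])
    (by simpa using h0)
  obtain ⟨c, rfl⟩ := eq_smul_X_pow_of_singular hs (hN hf).1 (hN hf).2 (h _ ⟨0, rfl⟩)
    (h _ ⟨1, rfl⟩) (h _ ⟨2, rfl⟩) (h _ ⟨3, rfl⟩) (h _ ⟨4, rfl⟩)
  have hc : c ≠ 0 := by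
    rintro rfl
    exact hf0 (zero_smul _ _)
  have := N.smul_mem c⁻¹ hf
  rwa [smul_smul, inv_mul_cancel₀ hc, one_smul] at this

/-! ### The explicit harmonic polynomials -/

/-- A monomial exponent, from the exponent `a` of `x_1`, those of `x_2, x_3, x_4` and those of
`x_5, x_6, x_7`. -/
noncomputable def expo (a : ℕ) (m m' : Fin 3 → ℕ) : Fin 7 →₀ ℕ :=
  Finsupp.equivFunOnFinite.symm ![a, m 0, m 1, m 2, m' 0, m' 1, m' 2]

theorem expo_apply (a : ℕ) (m m' : Fin 3 → ℕ) (i : Fin 7) :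
    expo a m m' i = (![a, m 0, m 1, m 2, m' 0, m' 1, m' 2] : Fin 7 → ℕ) i := rfl

theorem expo_inj {a b : ℕ} {m m' n n' : Fin 3 → ℕ} :
    expo a m m' = expo b n n' ↔ a = b ∧ m = n ∧ m' = n' := by
  constructor
  · intro h
    have h := fun i => DFunLike.congr_fun h i
    refine ⟨h 0, funext fun r => ?_, funext fun r => ?_⟩
    · fin_cases r
      exacts [h 1, h 2, h 3]
    · fin_cases r
      exacts [h 4, h 5, h 6]
  · rintro ⟨rfl, rfl, rfl⟩
    rfl

theorem expo_eta (d : Fin 7 →₀ ℕ) : expo (d 0) ![d 1, d 2, d 3] ![d 4, d 5, d 6] = d := by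
  ext i
  fin_cases i <;> rfl

theorem weight_one_expo (a : ℕ) (m m' : Fin 3 → ℕ) :
    Finsupp.weight 1 (expo a m m') = a + ∑ r, m r + ∑ r, m' r := by
  rw [Finsupp.weight_eq_sum]
  simp [Fin.sum_univ_seven, Fin.sum_univ_three, expo]
  ring

theorem monomial_expo (a : ℕ) (m m' : Fin 3 → ℕ) (c : F) :
    monomial (expo a m m') c = C c * X 0 ^ a *
      ∏ r : Fin 3, (X (![1, 2, 3] r) ^ m r * X (![4, 5, 6] r) ^ m' r) := by
  rw [monomial_eq, Finsupp.prod_fintype _ _ (by simp)]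
  simp [Fin.prod_univ_seven, Fin.prod_univ_three, expo]
  ring

theorem expo_sub_single_zero (a : ℕ) (m m' : Fin 3 → ℕ) :
    expo a m m' - Finsupp.single 0 1 = expo (a - 1) m m' := by
  ext i
  fin_cases i <;> simp [expo]

theorem expo_sub_single_sub_single (a : ℕ) (m m' : Fin 3 → ℕ) (r : Fin 3) :
    expo a m m' - Finsupp.single (![4, 5, 6] r) 1 - Finsupp.single (![1, 2, 3] r) 1 =
      expo a (m - Pi.single r 1) (m' - Pi.single r 1) := by
  ext i
  simp only [Finsupp.tsub_apply, expo_apply]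
  fin_cases r <;> fin_cases i <;> simp

theorem lap_eq_sum (f : MvPolynomial (Fin 7) F) :
    lap F f = pderiv 0 (pderiv 0 f) +
      ∑ r : Fin 3, C 2 * pderiv (![1, 2, 3] r) (pderiv (![4, 5, 6] r) f) := by
  rw [Fin.sum_univ_three]
  simp only [← smul_eq_C_mul, ← add_assoc]
  rfl

/-- The truncated exponents are harmless: wherever a subtraction truncates, the coefficient is zero.
-/
theorem lap_monomial_expo (a : ℕ) (m m' : Fin 3 → ℕ) (c : F) :
    lap F (monomial (expo a m m') c) = monomial (expo (a - 2) m m') (c * (a * (a - 1 : ℕ) : ℕ)) +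
      ∑ r, monomial (expo a (m - Pi.single r 1) (m' - Pi.single r 1))
        (2 * c * (m r * m' r : ℕ)) := by
  rw [lap_eq_sum]
  congr 1
  · rw [pderiv_monomial, pderiv_monomial, expo_sub_single_zero, expo_sub_single_zero,
      Nat.sub_sub]
    congr 1
    simp [expo, mul_assoc]
  · refine Finset.sum_congr rfl fun r _ => ?_
    rw [pderiv_monomial, pderiv_monomial, expo_sub_single_sub_single, C_mul_monomial]
    congr 1
    fin_cases r <;> simp [expo] <;> ring

/-- The numerators `∏ i_r! (m_r choose i_r) (m'_r choose i_r)`. -/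
def chooseProd (m m' i : Fin 3 → ℕ) : ℕ :=
  ∏ r, (i r).factorial * (m r).choose (i r) * (m' r).choose (i r)

theorem chooseProd_eq_zero {m m' i : Fin 3 → ℕ} (r : Fin 3) (h : m r < i r ∨ m' r < i r) :
    chooseProd m m' i = 0 := by
  refine Finset.prod_eq_zero (Finset.mem_univ r) ?_
  rcases h with h | h <;> simp [Nat.choose_eq_zero_of_lt h]

theorem succ_mul_chooseProd_add_single (m m' i : Fin 3 → ℕ) (r : Fin 3) :
    (i r + 1) * chooseProd m m' (i + Pi.single r 1) =
      chooseProd m m' i * ((m - i) r * (m' - i) r) := by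
  have h : ∏ x ∈ {r}ᶜ, ((i + Pi.single r 1 : Fin 3 → ℕ) x).factorial *
      (m x).choose ((i + Pi.single r 1 : Fin 3 → ℕ) x) *
      (m' x).choose ((i + Pi.single r 1 : Fin 3 → ℕ) x) =
      ∏ x ∈ {r}ᶜ, (i x).factorial * (m x).choose (i x) * (m' x).choose (i x) := by
    refine Finset.prod_congr rfl fun x hx => ?_
    have hx : x ≠ r := by simpa using hx
    simp [hx]
  rw [chooseProd, chooseProd, Fintype.prod_eq_mul_prod_compl r, h,
    Fintype.prod_eq_mul_prod_compl r]
  simp only [Pi.add_apply, Pi.single_eq_same, Pi.sub_apply, Nat.factorial_succ]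
  have h1 := Nat.choose_succ_right_eq (m r) (i r)
  have h2 := Nat.choose_succ_right_eq (m' r) (i r)
  generalize ∏ x ∈ {r}ᶜ, (i x).factorial * (m x).choose (i x) * (m' x).choose (i x) = P
  calc _ = (i r).factorial * ((m r).choose (i r + 1) * (i r + 1)) *
        ((m' r).choose (i r + 1) * (i r + 1)) * P := by ring
    _ = _ := by rw [h1, h2]; ring

variable (F) in
/-- The factor `(-2)^n n! / (ε + 2 n)!`. -/
def radialCoeff (ε n : ℕ) : F := (-2) ^ n * n.factorial / (ε + 2 * n).factorial

theorem radialCoeff_succ [CharZero F] (ε n : ℕ) :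
    radialCoeff F ε (n + 1) * ((ε + 2 * (n + 1)) * (ε + 2 * (n + 1) - 1) : ℕ) =
      -(2 * (n + 1) * radialCoeff F ε n) := by
  have h : (ε + 2 * (n + 1)).factorial =
      (ε + 2 * (n + 1)) * (ε + 2 * (n + 1) - 1) * (ε + 2 * n).factorial := by
    rw [show ε + 2 * (n + 1) = ε + 2 * n + 1 + 1 by ring, Nat.factorial_succ, Nat.factorial_succ,
      Nat.add_sub_cancel, mul_assoc]
  have h0 : (((ε + 2 * (n + 1)) * (ε + 2 * (n + 1) - 1) : ℕ) : F) ≠ 0 := by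
    rw [Nat.cast_ne_zero]
    exact mul_ne_zero (by omega) (by omega)
  have h1 : ((ε + 2 * n).factorial : F) ≠ 0 := Nat.cast_ne_zero.2 (Nat.factorial_ne_zero _)
  rw [radialCoeff, radialCoeff, h, Nat.cast_mul, Nat.factorial_succ, Nat.cast_mul (n + 1)]
  generalize (((ε + 2 * (n + 1)) * (ε + 2 * (n + 1) - 1) : ℕ) : F) = D at *
  field_simp
  push_cast
  ring

/-- With N = ∑ i_r, the multinomial coefficient is (2N)! / (N! ∏ i_r!), and (1 + 2εN) (2N)! = (ε +
2N)! because ε is 0 or 1. This form separates the dependence on N from a product over r, and each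
factor has a simple recursion. -/
theorem coeff_eq_radialCoeff_mul_chooseProd [CharZero F] (ε : Fin 2) (m m' i : Fin 3 → ℕ) :
    (-2 : F) ^ (∑ r, i r) * (∏ r, ((m r).choose (i r) : F) * ((m' r).choose (i r) : F)) /
        ((1 + 2 * (ε : ℕ) * (∑ r, i r) : ℕ) *
          (Nat.multinomial Finset.univ ![i 0, i 1, i 2, ∑ r, i r] : F)) =
      radialCoeff F ε (∑ r, i r) * chooseProd m m' i := by
  have hm := Nat.multinomial_spec Finset.univ ![i 0, i 1, i 2, ∑ r, i r]
  have hP : chooseProd m m' i = ((i 0).factorial * (i 1).factorial * (i 2).factorial) *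
      ∏ r, (m r).choose (i r) * (m' r).choose (i r) := by
    simp only [chooseProd, Fin.prod_univ_three]
    ring
  have hN : ∑ r, i r = i 0 + i 1 + i 2 := Fin.sum_univ_three _
  generalize Nat.multinomial Finset.univ ![i 0, i 1, i 2, ∑ r, i r] = M at *
  generalize ∑ r, i r = N at *
  rw [Fin.sum_univ_four, Fin.prod_univ_four] at hm
  simp only [Matrix.cons_val] at hm
  rw [show i 0 + i 1 + i 2 + N = 2 * N by omega] at hm
  have hf : ((ε : ℕ) + 2 * N).factorial = (1 + 2 * ε * N) * (2 * N).factorial := by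
    fin_cases ε
    · simp
    · rw [add_comm, Nat.factorial_succ]
      simp [add_comm]
  have hM : (M : F) ≠ 0 := by
    rw [Nat.cast_ne_zero]
    rintro rfl
    exact Nat.factorial_ne_zero (2 * N) (by simpa using hm.symm)
  have hε : ((1 + 2 * (ε : ℕ) * N : ℕ) : F) ≠ 0 := Nat.cast_ne_zero.2 (by omega)
  have hfac : ∀ n : ℕ, (n.factorial : F) ≠ 0 := fun n => Nat.cast_ne_zero.2 n.factorial_ne_zero
  have h0 := hfac (i 0)
  have h1 := hfac (i 1)
  have h2 := hfac (i 2)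
  have h3 := hfac N
  rw [radialCoeff, hf, ← hm, hP]
  push_cast at hε ⊢
  field_simp

theorem basisPoly_eq_sum_monomial [CharZero F] (ε : Fin 2) (m m' : Fin 3 → ℕ) :
    basisPoly F ε m m' = ∑ i ∈ Fintype.piFinset fun r => Finset.range (m r + 1),
      monomial (expo (ε + 2 * ∑ r, i r) (m - i) (m' - i))
        (radialCoeff F ε (∑ r, i r) * chooseProd m m' i) := by
  refine Finset.sum_congr rfl fun i _ => ?_
  rw [monomial_expo, coeff_eq_radialCoeff_mul_chooseProd]
  rfl

/-- Shifting the box by one in direction r drops the face j_r = 0 and adds the face j_r = m_r + 1,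
on both of which g vanishes. -/
theorem sum_piFinset_range_add_single {M : Type*} [AddCommMonoid M] {n : ℕ} (m : Fin n → ℕ)
    (r : Fin n) (g : (Fin n → ℕ) → M) (h0 : ∀ j, j r = 0 → g j = 0)
    (h1 : ∀ j, m r < j r → g j = 0) :
    ∑ i ∈ Fintype.piFinset fun r => Finset.range (m r + 1), g (i + Pi.single r 1) =
      ∑ i ∈ Fintype.piFinset fun r => Finset.range (m r + 1), g i := by
  refine Finset.sum_bij_ne_zero (fun i _ _ => i + Pi.single r 1) ?_ ?_ ?_ ?_
  · intro i hi hg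
    rw [Fintype.mem_piFinset] at hi ⊢
    intro x
    by_cases hx : x = r
    · subst hx
      rw [Finset.mem_range, Nat.lt_succ_iff]
      by_contra hc
      exact hg (h1 _ (not_le.1 hc))
    · simpa [hx] using hi x
  · intro i _ _ j _ _ h
    exact add_right_cancel h
  · intro j hj hg
    have hr : j r ≠ 0 := fun h => hg (h0 j h)
    have hle : Pi.single r 1 ≤ j := by
      intro x
      by_cases hx : x = r
      · subst hx
        simpa using Nat.one_le_iff_ne_zero.2 hr
      · simp [hx]
    refine ⟨j - Pi.single r 1, ?_, ?_, tsub_add_cancel_of_le hle⟩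
    · rw [Fintype.mem_piFinset] at hj ⊢
      intro x
      have := hj x
      rw [Finset.mem_range] at this ⊢
      exact (Nat.sub_le _ _).trans_lt this
    · rwa [tsub_add_cancel_of_le hle]
  · intro i _ _
    rfl

theorem lap_basisPoly [CharZero F] (ε : Fin 2) (m m' : Fin 3 → ℕ) :
    lap F (basisPoly F ε m m') = 0 := by
  -- For j_r ≥ 1, `g r j` is what the r-th mixed derivative makes of the term j - e_r; for j_r = 0
  -- the factor j_r kills it, so the truncated subtractions do not matter. Applied to the term j,
  -- ∂_1² gives -∑_r `g r j`, and the total telescopes after a shift of the index.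
  let g : Fin 3 → (Fin 3 → ℕ) → MvPolynomial (Fin 7) F := fun r j =>
    monomial (expo (ε + 2 * (∑ r, j r) - 2) (m - j) (m' - j))
      (2 * radialCoeff F ε (∑ r, j r - 1) * (j r * chooseProd m m' j : ℕ))
  have hsum : ∀ (i : Fin 3 → ℕ) r, ∑ x, (i + Pi.single r 1 : Fin 3 → ℕ) x = ∑ x, i x + 1 := by
    intro i r
    simp [Finset.sum_add_distrib]
  have h1 : ∀ i : Fin 3 → ℕ, monomial (expo (ε + 2 * (∑ r, i r) - 2) (m - i) (m' - i))
      (radialCoeff F ε (∑ r, i r) * chooseProd m m' i *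
        ((ε + 2 * (∑ r, i r)) * (ε + 2 * (∑ r, i r) - 1 : ℕ) : ℕ)) = -∑ r, g r i := by
    intro i
    simp only [g, ← map_sum, ← map_neg]
    congr 1
    rw [← Finset.mul_sum, ← Nat.cast_sum, ← Finset.sum_mul]
    generalize ∑ r, i r = N
    cases N with
    -- Both sides vanish here, as ε(ε - 1) = 0.
    | zero => fin_cases ε <;> simp
    | succ N =>
      rw [mul_right_comm, radialCoeff_succ, Nat.add_sub_cancel]
      push_cast
      ring
  have h2 : ∀ (i : Fin 3 → ℕ) r,
      monomial (expo (ε + 2 * ∑ r, i r) (m - i - Pi.single r 1) (m' - i - Pi.single r 1))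
        (2 * (radialCoeff F ε (∑ r, i r) * chooseProd m m' i) * ((m - i) r * (m' - i) r : ℕ)) =
      g r (i + Pi.single r 1) := by
    intro i r
    simp only [g, hsum, Nat.add_sub_cancel, tsub_add_eq_tsub_tsub]
    congr 1
    rw [Pi.add_apply, Pi.single_eq_same, succ_mul_chooseProd_add_single]
    push_cast
    ring
  rw [basisPoly_eq_sum_monomial, map_sum]
  simp only [lap_monomial_expo, h1, h2, Finset.sum_add_distrib]
  rw [Finset.sum_neg_distrib, neg_add_eq_zero]
  refine Finset.sum_comm.trans (Eq.trans ?_ Finset.sum_comm)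
  refine Finset.sum_congr rfl fun r _ => (sum_piFinset_range_add_single m r (g r) ?_ ?_).symm
  · intro j hj
    simp [g, hj]
  · intro j hj
    simp [g, chooseProd_eq_zero r (.inl hj)]

theorem basisPoly_isHomogeneous [CharZero F] (ε : Fin 2) (m m' : Fin 3 → ℕ) :
    (basisPoly F ε m m').IsHomogeneous (ε + ∑ r, m r + ∑ r, m' r) := by
  rw [basisPoly_eq_sum_monomial]
  refine IsHomogeneous.sum _ _ _ fun i _ => ?_
  -- If some i_r exceeds m_r or m'_r, the truncated exponents give the wrong degree, but the
  -- coefficient is zero.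
  by_cases h : ∀ r, i r ≤ m r ∧ i r ≤ m' r
  · have := isHomogeneous_monomial (d := expo (ε + 2 * ∑ r, i r) (m - i) (m' - i))
      (n := ε + ∑ r, m r + ∑ r, m' r) (radialCoeff F ε (∑ r, i r) * chooseProd m m' i)
    apply this
    rw [Finsupp.degree_eq_weight_one]
    refine (weight_one_expo _ _ _).trans ?_
    have h0 := h 0
    have h1 := h 1
    have h2 := h 2
    simp only [Fin.sum_univ_three, Pi.sub_apply]
    omega
  · simp only [not_forall, not_and_or, not_le] at h
    obtain ⟨r, hr⟩ := h
    rw [chooseProd_eq_zero r hr]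
    simpa using isHomogeneous_zero _ _ _

theorem coeff_basisPoly [CharZero F] (ε ε' : Fin 2) (m m' n n' : Fin 3 → ℕ) :
    coeff (expo ε' n n') (basisPoly F ε m m') = if ε = ε' ∧ m = n ∧ m' = n' then 1 else 0 := by
  rw [basisPoly_eq_sum_monomial, coeff_sum, Finset.sum_eq_single 0]
  · simp only [coeff_monomial, expo_inj]
    simp [radialCoeff, chooseProd, Fin.val_inj, Nat.factorial_eq_one.2 ε.is_le]
  · intro i _ hi
    rw [coeff_monomial, if_neg]
    rw [expo_inj]
    rintro ⟨h, -⟩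
    apply hi
    -- Since ε + 2 ∑ i_r = ε' < 2, only the term i = 0 can contribute.
    have h0 : ∑ r, i r = 0 := by omega
    funext r
    exact Finset.sum_eq_zero_iff.1 h0 r (Finset.mem_univ r)
  · simp

/-- Induction on the exponent of x_1: the coefficient of x^d in Δ' f is (d_1 + 1)(d_1 + 2) times the
coefficient of x_1² x^d in f, plus multiples of coefficients whose x_1-exponent is only d_1. -/
theorem eq_zero_of_lap_eq_zero [CharZero F] {f : MvPolynomial (Fin 7) F} (hl : lap F f = 0)
    (h : ∀ (ε : Fin 2) m m', coeff (expo ε m m') f = 0) : f = 0 := by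
  have key : ∀ n, ∀ d : Fin 7 →₀ ℕ, d 0 = n → coeff d f = 0 := by
    intro n
    induction n using Nat.strong_induction_on with
    | _ n ih =>
      intro d hd
      by_cases hn : n < 2
      · rw [← expo_eta d]
        exact h ⟨d 0, hd ▸ hn⟩ _ _
      · obtain ⟨d, rfl⟩ : ∃ d', d = d' + Finsupp.single 0 1 + Finsupp.single 0 1 := by
          refine ⟨d - Finsupp.single 0 1 - Finsupp.single 0 1, ?_⟩
          ext i
          by_cases hi : i = 0
          · subst hi
            simp
            omega
          · simp [Ne.symm hi]
        have hc := congrArg (coeff d) hl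
        simp only [Finsupp.add_apply, Finsupp.single_eq_same] at hd
        rw [lap_eq_sum, coeff_add, coeff_sum, Finset.sum_eq_zero, coeff_pderiv, coeff_pderiv,
          add_zero, coeff_zero, mul_assoc, mul_eq_zero] at hc
        · exact hc.resolve_right
            (mul_ne_zero (Nat.cast_add_one_ne_zero _) (Nat.cast_add_one_ne_zero _))
        · intro r _
          rw [coeff_C_mul, coeff_pderiv, coeff_pderiv, ih (d 0) (by omega)]
          · simp
          · fin_cases r <;> simp
  ext d
  exact key _ d rfl

/-! ### The apolar form -/

variable (F) in
/-- The apolar form: the monomials are orthogonal, and `x^d` has square `d!`. -/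
noncomputable def apolar :
    MvPolynomial (Fin 7) F →ₗ[F] MvPolynomial (Fin 7) F →ₗ[F] F :=
  (basisMonomials (Fin 7) F).constr F fun d => (∏ i, (d i).factorial : F) • lcoeff F d

theorem apolar_monomial (d : Fin 7 →₀ ℕ) (c : F) (g : MvPolynomial (Fin 7) F) :
    apolar F (monomial d c) g = c * ((∏ i, (d i).factorial : F) * coeff d g) := by
  have h : apolar F (monomial d 1) = (∏ i, (d i).factorial : F) • lcoeff F d := by
    have := (basisMonomials (Fin 7) F).constr_basis F
      (fun d => (∏ i, (d i).factorial : F) • lcoeff F d) d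
    rwa [coe_basisMonomials] at this
  rw [← mul_one c, ← smul_eq_mul, ← smul_monomial, map_smul, h, smul_eq_mul, mul_one]
  rfl

theorem apolar_comm (f g : MvPolynomial (Fin 7) F) : apolar F f g = apolar F g f := by
  induction f using MvPolynomial.induction_on' with
  | add p q hp hq => rw [map_add, map_add, LinearMap.add_apply, hp, hq]
  | monomial d c =>
    induction g using MvPolynomial.induction_on' with
    | add p q hp hq => rw [map_add, map_add, LinearMap.add_apply, hp, hq]
    | monomial e b =>
      classical
      rw [apolar_monomial, apolar_monomial, coeff_monomial, coeff_monomial]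
      by_cases h : d = e
      · subst h
        simp
        ring
      · rw [if_neg h, if_neg (Ne.symm h)]
        simp

theorem apolar_X_mul (i : Fin 7) (f g : MvPolynomial (Fin 7) F) :
    apolar F (X i * f) g = apolar F f (pderiv i g) := by
  induction f using MvPolynomial.induction_on' with
  | add p q hp hq =>
    rw [mul_add, map_add, map_add, LinearMap.add_apply, LinearMap.add_apply, hp, hq]
  | monomial d c =>
    rw [X, monomial_mul, one_mul, add_comm, apolar_monomial, apolar_monomial, coeff_pderiv]
    have h : (∏ j, ((d + Finsupp.single i 1 : Fin 7 →₀ ℕ) j).factorial : F) =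
        (d i + 1) * ∏ j, ((d j).factorial : F) := by
      rw [Fintype.prod_eq_mul_prod_compl i, Fintype.prod_eq_mul_prod_compl i, ← mul_assoc]
      congr 1
      · rw [Finsupp.add_apply, Finsupp.single_eq_same, Nat.factorial_succ]
        push_cast
        ring
      · refine Finset.prod_congr rfl fun x hx => ?_
        have hx : x ≠ i := by simpa using hx
        simp [hx]
    rw [h]
    ring

/-- Multiplication by x_i is adjoint to ∂_i and the form is symmetric, so x_i ∂_j is adjoint to x_j
∂_i. -/
theorem apolar_lie (A : Matrix (Fin 7) (Fin 7) F) (f g : MvPolynomial (Fin 7) F) :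
    apolar F ⁅A, f⁆ g = apolar F f ⁅A.transpose, g⁆ := by
  rw [lie_eq, lie_eq, Finset.sum_comm]
  simp only [map_sum, map_smul, LinearMap.sum_apply, LinearMap.smul_apply, Matrix.transpose_apply]
  refine Finset.sum_congr rfl fun i _ => Finset.sum_congr rfl fun j _ => ?_
  rw [apolar_X_mul, apolar_comm, ← apolar_X_mul, apolar_comm]

theorem apolar_X_pow_self (i : Fin 7) (k : ℕ) :
    apolar F (X i ^ k) (X i ^ k) = k.factorial := by
  rw [X_pow_eq_monomial, apolar_monomial, coeff_monomial, if_pos rfl,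
    Finset.prod_eq_single i]
  · simp
  · intro j _ hj
    simp [hj]
  · simp

/-! ### The basis of the harmonic polynomials and their identification with V_k -/

instance (k : ℕ) : Finite (Index k) := by
  have hle : ∀ (p : Index k) r, p.1.2.1 r ≤ k ∧ p.1.2.2 r ≤ k := by
    rintro ⟨⟨ε, m, m'⟩, h⟩ r
    have h1 := Finset.single_le_sum (f := m) (fun _ _ => Nat.zero_le _) (Finset.mem_univ r)
    have h2 := Finset.single_le_sum (f := m') (fun _ _ => Nat.zero_le _) (Finset.mem_univ r)
    simp only at h h1 h2 ⊢
    omega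
  refine Finite.of_injective (β := Fin 2 × (Fin 3 → Fin (k + 1)) × (Fin 3 → Fin (k + 1)))
    (fun p => (p.1.1, fun r => ⟨p.1.2.1 r, Nat.lt_succ_of_le (hle p r).1⟩,
      fun r => ⟨p.1.2.2 r, Nat.lt_succ_of_le (hle p r).2⟩)) ?_
  rintro ⟨⟨ε, m, m'⟩, h⟩ ⟨⟨δ, n, n'⟩, h'⟩ he
  simp only [Prod.mk.injEq, funext_iff, Fin.mk.injEq] at he
  obtain ⟨rfl, h1, h2⟩ := he
  obtain rfl := funext h1
  obtain rfl := funext h2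
  rfl

variable (F) in
/-- The coefficients of degree at most one in `x_1`. -/
noncomputable def lowCoeff (k : ℕ) : MvPolynomial (Fin 7) F →ₗ[F] Index k → F :=
  LinearMap.pi fun p => lcoeff F (expo p.1.1 p.1.2.1 p.1.2.2)

theorem V_le_harmonic (s : F) (hs : s ^ 2 = 2) (k : ℕ) : V s hs k ≤ harmonic s hs k := by
  rw [V, LieSubmodule.lieSpan_le, Set.singleton_subset_iff]
  exact X_pow_mem_harmonic s hs k

theorem X_pow_mem_V (s : F) (hs : s ^ 2 = 2) (k : ℕ) : X 3 ^ k ∈ V s hs k :=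
  LieSubmodule.subset_lieSpan rfl

/-- The harmonic polynomials orthogonal to a submodule under the apolar form. -/
noncomputable def harmonicOrthogonal {s : F} {hs : s ^ 2 = 2} (k : ℕ)
    (N : LieSubmodule F (g2 s hs) (MvPolynomial (Fin 7) F)) :
    LieSubmodule F (g2 s hs) (MvPolynomial (Fin 7) F) where
  __ := (harmonic s hs k).toSubmodule ⊓ N.toSubmodule.dualAnnihilator.comap (apolar F)
  lie_mem := by
    rintro A f ⟨h1, h2⟩
    refine ⟨(harmonic s hs k).lie_mem h1, ?_⟩
    refine (Submodule.mem_dualAnnihilator _).2 fun g hg => ?_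
    change apolar F ⁅(A : Matrix (Fin 7) (Fin 7) F), f⁆ g = 0
    rw [apolar_lie]
    exact (Submodule.mem_dualAnnihilator _).1 h2 _
      (N.lie_mem (x := ⟨_, transpose_mem A.2⟩) hg)

variable [CharZero F]

theorem eq_zero_of_lowCoeff_eq_zero {s : F} {hs : s ^ 2 = 2} {k : ℕ}
    {f : MvPolynomial (Fin 7) F} (hf : f ∈ harmonic s hs k) (h : lowCoeff F k f = 0) : f = 0 := by
  refine eq_zero_of_lap_eq_zero hf.2 fun ε m m' => ?_
  by_cases hk : (ε : ℕ) + ∑ r, m r + ∑ r, m' r = k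
  · exact congrFun h ⟨(ε, m, m'), hk⟩
  · by_contra hc
    have := hf.1 hc
    rw [weight_one_expo] at this
    exact hk this

theorem basisPoly_mem_harmonic (s : F) (hs : s ^ 2 = 2) {k : ℕ} (p : Index k) :
    basisPoly F p.1.1 p.1.2.1 p.1.2.2 ∈ harmonic s hs k := by
  have h := basisPoly_isHomogeneous (F := F) p.1.1 p.1.2.1 p.1.2.2
  rw [p.2] at h
  exact mem_harmonic.2 ⟨h, lap_basisPoly _ _ _⟩

theorem lowCoeff_basisPoly {k : ℕ} (p q : Index k) :
    lowCoeff F k (basisPoly F p.1.1 p.1.2.1 p.1.2.2) q = if p = q then 1 else 0 := by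
  change coeff (expo q.1.1 q.1.2.1 q.1.2.2) _ = _
  rw [coeff_basisPoly]
  refine if_congr ?_ rfl rfl
  rw [Subtype.ext_iff, Prod.ext_iff, Prod.ext_iff]

/-- On harmonic polynomials `lowCoeff` is injective, and it sends the explicit polynomials to the
standard basis of `Index k → F`; hence it is an isomorphism and they form a basis. -/
theorem exists_basis_harmonic (s : F) (hs : s ^ 2 = 2) (k : ℕ) :
    ∃ b : Module.Basis (Index k) F (harmonic s hs k),
      ∀ p, (b p : MvPolynomial (Fin 7) F) = basisPoly F p.1.1 p.1.2.1 p.1.2.2 := by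
  have := Fintype.ofFinite (Index k)
  let φ : harmonic s hs k →ₗ[F] Index k → F :=
    lowCoeff F k ∘ₗ (harmonic s hs k).toSubmodule.subtype
  let v : Index k → harmonic s hs k := fun p => ⟨_, basisPoly_mem_harmonic s hs p⟩
  have hφ : ∀ x, φ (∑ p, x p • v p) = x := by
    intro x
    funext q
    rw [map_sum, Finset.sum_apply, Finset.sum_eq_single q]
    · have : φ (v q) q = 1 := (lowCoeff_basisPoly q q).trans (if_pos rfl)
      rw [map_smul, Pi.smul_apply, this, smul_eq_mul, mul_one]
    · intro p _ hp
      have : φ (v p) q = 0 := (lowCoeff_basisPoly p q).trans (if_neg hp)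
      rw [map_smul, Pi.smul_apply, this, smul_zero]
    · simp
  have hinj : Function.Injective φ := (injective_iff_map_eq_zero φ).2 fun f h =>
    Subtype.ext (eq_zero_of_lowCoeff_eq_zero f.2 h)
  have hv : ∀ p, φ (v p) = Pi.single p 1 := by
    intro p
    funext q
    refine (lowCoeff_basisPoly p q).trans ?_
    rw [Pi.single_apply]
    exact if_congr eq_comm rfl rfl
  let e := LinearEquiv.ofBijective φ ⟨hinj, fun x => ⟨_, hφ x⟩⟩
  refine ⟨Module.Basis.ofEquivFun e, fun p => ?_⟩
  have : e.symm (Pi.single p 1) = v p := by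
    rw [LinearEquiv.symm_apply_eq]
    exact (hv p).symm
  rw [Module.Basis.coe_ofEquivFun]
  exact congrArg Subtype.val this

/-- Over a general field the apolar form may have isotropic vectors, so positivity is unavailable;
⟨x_4^k, x_4^k⟩ = k! ≠ 0 is enough to make the orthogonal of V_k trivial. The basis is used here only
for finite dimensionality. -/
theorem V_eq_harmonic (s : F) (hs : s ^ 2 = 2) (k : ℕ) : V s hs k = harmonic s hs k := by
  have horth : harmonicOrthogonal k (V s hs k) = ⊥ := by
    by_contra h
    have hX : X 3 ^ k ∈ harmonicOrthogonal k (V s hs k) :=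
      X_pow_mem_of_ne_bot (fun f hf => hf.1) h
    have h0 : apolar F (X 3 ^ k) (X 3 ^ k) = 0 :=
      (Submodule.mem_dualAnnihilator _).1 hX.2 _ (X_pow_mem_V s hs k)
    rw [apolar_X_pow_self] at h0
    exact Nat.factorial_ne_zero k (by exact_mod_cast h0)
  obtain ⟨b, -⟩ := exists_basis_harmonic s hs k
  have hfin : FiniteDimensional F (harmonic s hs k).toSubmodule := Module.Finite.of_basis b
  have hle : (V s hs k).toSubmodule ≤ (harmonic s hs k).toSubmodule := V_le_harmonic s hs k
  have hfinV : FiniteDimensional F (V s hs k).toSubmodule :=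
    Submodule.finiteDimensional_of_le hle
  let φ : (harmonic s hs k).toSubmodule →ₗ[F] Module.Dual F (V s hs k).toSubmodule :=
    (V s hs k).toSubmodule.dualRestrict ∘ₗ apolar F ∘ₗ (harmonic s hs k).toSubmodule.subtype
  have hφ : Function.Injective φ := by
    refine (injective_iff_map_eq_zero φ).2 fun f hf => Subtype.ext ?_
    have : (f : MvPolynomial (Fin 7) F) ∈ harmonicOrthogonal k (V s hs k) :=
      ⟨f.2, (Submodule.mem_dualAnnihilator _).2 fun g hg => DFunLike.congr_fun hf ⟨g, hg⟩⟩
    rw [horth] at this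
    exact this
  have hrank := LinearMap.finrank_le_finrank_of_injective hφ
  rw [Subspace.dual_finrank_eq] at hrank
  exact LieSubmodule.toSubmodule_injective (Submodule.eq_of_le_of_finrank_le hle hrank)

theorem isIrreducible_V (s : F) (hs : s ^ 2 = 2) (k : ℕ) :
    LieModule.IsIrreducible F (g2 s hs) (V s hs k) := by
  have : Nontrivial (V s hs k) :=
    ⟨⟨⟨_, X_pow_mem_V s hs k⟩, 0, fun h =>
      pow_ne_zero k (X_ne_zero (R := F) (3 : Fin 7)) (congrArg Subtype.val h)⟩⟩
  refine LieModule.IsIrreducible.mk fun N hN => ?_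
  -- N is moved into the polynomial ring, where it contains x_4^k and therefore all of V_k.
  have h1 : N.map (V s hs k).incl ≠ ⊥ := by
    intro h
    apply hN
    rw [LieSubmodule.eq_bot_iff]
    intro f hf
    have := LieSubmodule.mem_map_of_mem (f := (V s hs k).incl) hf
    rw [h] at this
    exact Subtype.ext this
  have h2 : N.map (V s hs k).incl ≤ V s hs k := LieSubmodule.map_incl_le
  have h3 := X_pow_mem_of_ne_bot (h2.trans (V_le_harmonic s hs k)) h1
  rw [LieSubmodule.mem_map] at h3
  have h4 : V s hs k ≤ N.map (V s hs k).incl := by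
    refine LieSubmodule.lieSpan_le.2 (Set.singleton_subset_iff.2 ?_)
    exact (LieSubmodule.mem_map _).2 h3
  rw [eq_top_iff]
  intro f _
  obtain ⟨g, hg, hgf⟩ := (LieSubmodule.mem_map _).1 (h4 f.2)
  rwa [← Subtype.ext hgf]

end

end G2Poly

theorem theorem4p5 {F : Type*} [Field F] [CharZero F] (s : F) (hs : s ^ 2 = 2) (k : ℕ) :
    -- `V_k` is irreducible, of highest weight `k λ_1`
    LieModule.IsIrreducible F (G2Poly.g2 s hs) (G2Poly.V s hs k) ∧
    G2Poly.IsHighestWeightVector s hs (G2Poly.V s hs k) (MvPolynomial.X 3 ^ k)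
      (k • G2Poly.fundWeight₁ F) ∧
    -- `V_k` is the kernel of `Δ'` in degree `k`
    (G2Poly.V s hs k).toSubmodule =
      MvPolynomial.homogeneousSubmodule (Fin 7) F k ⊓ LinearMap.ker (G2Poly.lap F) ∧
    -- the explicit polynomials form a basis of `V_k`
    ∃ b : Module.Basis (G2Poly.Index k) F (G2Poly.V s hs k),
      ∀ p, (b p : MvPolynomial (Fin 7) F) = G2Poly.basisPoly F p.1.1 p.1.2.1 p.1.2.2 := by
  refine ⟨G2Poly.isIrreducible_V s hs k, ⟨G2Poly.isSingular_X_pow s k, rfl⟩, ?_, ?_⟩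
  · rw [G2Poly.V_eq_harmonic]
    rfl
  · rw [G2Poly.V_eq_harmonic]
    exact G2Poly.exists_basis_harmonic s hs k
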